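/- Let $m,n\ge 2$ and let $0\le s\le R$ be integers with $R\le\frac12(m-1)(n-2)$. For $x^i\in\mathbb R^m$, $y^i\in\mathbb R^n$ ($1\le i\le s$) and $z^i\in\mathbb R^{m\times n}$ ($s<i\le R$), put $v^i=x^i(y^i)^\top$ for $i\le s$, $v^i=z^i$ for $i>s$, and $\mathcal U=\mathrm{span}\{v^1,\dots,v^R\}\subseteq\mathbb R^{m\times n}$. A property holds generically in some real variables if it holds wherever a certain polynomial in these variables, not identically zero, does not vanish. The JLV algorithm (in exact real arithmetic). Input: a basis of $\mathcal U$. 1. Compute a basis $P_1,\dots,P_d$ of $S^2(\mathcal U)\cap\mathrm{span}\{E_{abcd}: a<c,\ b<d\}^\perp$, where $S^2(\mathcal U)=\mathrm{span}\{u\vee u':u,u'\in\mathcal U\}$, $u\vee u'=\frac12(u\otimes u'+u'\otimes u)$, $E_{abcd}=e_{ab}\vee e_{cd}-e_{ad}\vee e_{cb}$, $e_{ab}$ is the matrix with $1$ in entry $(a,b)$ and $0$ elsewhere, and $\perp$ is taken for the entrywise inner product. If $d=0$, output "$\mathcal U$ contains no nonzero matrix of rank one". 2. If $d>0$, apply simultaneous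 diagonalization to the tensor $\sum_l e_l\otimes P_l$ of order three: choose $g,h\in\mathbb R^d$ at random, and set $A=\sum_l g_lP_l$, $B=\sum_l h_lP_l$, regarded as $mn\times mn$ matrices. With ${}^+$ denoting the Moore–Penrose pseudoinverse, compute the nonzero real eigenvalues of $AB^+$ and of $(A^+B)^\top$, with eigenvectors. If all these eigenvalues have one-dimensional eigenspaces, pair each eigenvector $\hat x^i$ of the first matrix with the eigenvector $\hat y^i$ of the second one that belongs to the reciprocal eigenvalue, and solve $\sum_l e_l\otimes P_l=\sum_i \hat z^i\otimes\hat x^i\otimes\hat y^i$ for the vectors $\hat z^i$. If all of this succeeds, output the vectors $\hat x^i$, read as $m\times n$ matrices; otherwise output "fail". Then for generically chosen $x,y,z$, for every basis of $\mathcal U$ given as input and every basis $P_1,\dots,P_d$ computed in step 1, and for generically chosen $g,h$ (in particular for all $(g,h)$ outside a set of measure zero), the algorithm succeeds, whatever the order and scaling of the eigenvectors: - if $s>0$, it outputs exactly $s$ matrices $\hat v^1,\dots,\hat v^s$, and there are a permutation $\pi$ of $\{1,\dots,s\}$ and nonzero scalars $\alpha_1,\dots,\alpha_s$ with $\hat v^i=\alpha_i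 v^{\pi(i)}$ for all $i$; - if $s=0$, it outputs the certificate that $\mathcal U$ contains no nonzero matrix of rank one, and this is true. -/

import Mathlib

open scoped Matrix

noncomputable section

namespace JLV

/-- A property of `w` holds generically: it holds off the zero set of a nonzero polynomial. -/
def Generic {σ : Type} (Q : (σ → ℝ) → Prop) : Prop :=
  ∃ p : MvPolynomial σ ℝ, p ≠ 0 ∧ ∀ w : σ → ℝ, MvPolynomial.eval w p ≠ 0 → Q w

/-- The ambient space of real `m × n` matrices. -/
abbrev Mat (m n : ℕ) : Type := Matrix (Fin m) (Fin n) ℝ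

/-- 2-tensors over the space of `m × n` matrices, as arrays of coordinates: the rows and the
columns are indexed by the positions of a matrix. -/
abbrev Tensor (m n : ℕ) : Type := Matrix (Fin m × Fin n) (Fin m × Fin n) ℝ

/-- Matrices of rank at most one. -/
def rankOne (m n : ℕ) : Set (Mat m n) :=
  {v | ∃ (x : Fin m → ℝ) (y : Fin n → ℝ), v = Matrix.vecMulVec x y}

/-! ### The planted subspace -/

/-- The symbolic variables: the entries of `x^i` and `y^i` for each planted matrix, and the
entries of `z^i` for each non-planted matrix. -/
abbrev Var (m n R s : ℕ) : Type :=
  (Fin s × Fin m) ⊕ (Fin s × Fin n) ⊕ (Fin (R - s) × Fin m × Fin n)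

variable {m n R s : ℕ}

/-- The planted matrix `v^i = x^i (y^i)ᵀ`. -/
def planted (w : Var m n R s → ℝ) (i : Fin s) : Mat m n :=
  Matrix.vecMulVec (fun a => w (.inl (i, a))) (fun b => w (.inr (.inl (i, b))))

/-- The non-planted matrix `v^{s+i} = z^{s+i}`. -/
def nonPlanted (w : Var m n R s → ℝ) (i : Fin (R - s)) : Mat m n :=
  Matrix.of fun a b => w (.inr (.inr (i, a, b)))

/-- The span of all the planted and non-planted matrices. -/
def plantedSubspace (w : Var m n R s → ℝ) : Submodule ℝ (Mat m n) :=
  Submodule.span ℝ (Set.range (planted w) ∪ Set.range (nonPlanted w))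

/-! ### Symmetric tensors and the tensors of the 2 × 2 minors -/

/-- The coordinate vector of a matrix. -/
def vec (v : Mat m n) : Fin m × Fin n → ℝ := fun p => v p.1 p.2

/-- The matrix with given coordinate vector. -/
def unvec (x : Fin m × Fin n → ℝ) : Mat m n := Matrix.of fun a b => x (a, b)

/-- The tensor `u ⊗ u'`. -/
def tensorProd (u u' : Mat m n) : Tensor m n := Matrix.vecMulVec (vec u) (vec u')

/-- The symmetric tensor `u ∨ u'`. -/
def sprod (u u' : Mat m n) : Tensor m n :=
  (1 / 2 : ℝ) • tensorProd u u' + (1 / 2 : ℝ) • tensorProd u' u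

/-- `S²(U)`. -/
def symSquare (U : Submodule ℝ (Mat m n)) : Submodule ℝ (Tensor m n) :=
  Submodule.span ℝ {T | ∃ u ∈ U, ∃ u' ∈ U, T = sprod u u'}

/-- The entrywise inner product of tensors. -/
def tensorInner (T S : Tensor m n) : ℝ := ∑ p, ∑ q, T p q * S p q

/-- The orthogonal complement of a space of tensors. -/
def perp (L : Submodule ℝ (Tensor m n)) : Submodule ℝ (Tensor m n) where
  carrier := {T | ∀ S ∈ L, tensorInner T S = 0}
  zero_mem' := by intro S _; simp [tensorInner]
  add_mem' := by
    intro T T' hT hT' S hS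
    have h1 := hT S hS
    have h2 := hT' S hS
    simp only [tensorInner] at h1 h2 ⊢
    simp [add_mul, Finset.sum_add_distrib, h1, h2]
  smul_mem' := by
    intro c T hT S hS
    have h1 := hT S hS
    simp only [tensorInner] at h1 ⊢
    simp [mul_assoc, ← Finset.mul_sum, h1]

/-- The symmetric tensor `E_{abcd}` of the minor `v_{ab} v_{cd} - v_{ad} v_{cb}`. -/
def minorTensor (a : Fin m) (b : Fin n) (c : Fin m) (d : Fin n) : Tensor m n :=
  sprod (Matrix.single a b 1) (Matrix.single c d 1) -
    sprod (Matrix.single a d 1) (Matrix.single c b 1)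

/-- The span of the tensors `E_{abcd}` with `a < c` and `b < d`. -/
def minorSpan (m n : ℕ) : Submodule ℝ (Tensor m n) :=
  Submodule.span ℝ {T | ∃ (a c : Fin m) (b d : Fin n), a < c ∧ b < d ∧ T = minorTensor a b c d}

/-! ### Simultaneous diagonalization of a tensor of order three -/

section SimDiag

variable {ι κ : Type} [Fintype ι] [Fintype κ]

/-- `B` is the Moore–Penrose pseudoinverse of the real matrix `A`. -/
structure IsPseudoinverse (A : Matrix ι κ ℝ) (B : Matrix κ ι ℝ) : Prop where
  mul_mul_left : A * B * A = A
  mul_mul_right : B * A * B = B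
  symm_left : (A * B)ᵀ = A * B
  symm_right : (B * A)ᵀ = B * A

/-- `lam` lists the nonzero real eigenvalues of `M` without repetition, each of them has a
one-dimensional eigenspace, and `x i` is an eigenvector for `lam i`. -/
structure IsEigenList [DecidableEq ι] (M : Matrix ι ι ℝ) {r : ℕ} (lam : Fin r → ℝ)
    (x : Fin r → ι → ℝ) : Prop where
  injective : Function.Injective lam
  ne_zero : ∀ i, lam i ≠ 0
  complete : ∀ c : ℝ, c ≠ 0 → Module.End.HasEigenvalue (Matrix.toLin' M) c → ∃ i, lam i = c
  vec_ne_zero : ∀ i, x i ≠ 0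
  eigenspace_eq : ∀ i,
    Module.End.eigenspace (Matrix.toLin' M) (lam i) = Submodule.span ℝ {x i}

/-- The decomposition `∑ i, z i ⊗ x i ⊗ y i` is what simultaneous diagonalization returns on the
tensor `∑ l, e l ⊗ T l` of order three with slices `T l`, when the slices are contracted with the
vectors `g` and `h`. With `A = ∑ l, g l • T l` and `B = ∑ l, h l • T l`, the procedure

* computes the eigenvectors of `A * B⁺` and of `(A⁺ * B)ᵀ` for the nonzero eigenvalues,
* pairs each eigenvector `x i` of the first matrix with an eigenvector `y i` of the second one
  that belongs to the reciprocal eigenvalue,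
* solves the linear system `∑ l, e l ⊗ T l = ∑ i, z i ⊗ x i ⊗ y i` for the vectors `z i`. -/
def IsSimDiag [DecidableEq ι] [DecidableEq κ] {d : ℕ} (T : Fin d → Matrix ι κ ℝ)
    (g h : Fin d → ℝ) {r : ℕ}
    (z : Fin r → Fin d → ℝ) (x : Fin r → ι → ℝ) (y : Fin r → κ → ℝ) : Prop :=
  ∃ (A' B' : Matrix κ ι ℝ) (lam mu : Fin r → ℝ) (y₀ : Fin r → κ → ℝ) (σ : Equiv.Perm (Fin r)),
    IsPseudoinverse (∑ l, g l • T l) A' ∧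
    IsPseudoinverse (∑ l, h l • T l) B' ∧
    IsEigenList ((∑ l, g l • T l) * B') lam x ∧
    IsEigenList (A' * ∑ l, h l • T l)ᵀ mu y₀ ∧
    (∀ i, lam i * mu (σ i) = 1) ∧
    (∀ i, y i = y₀ (σ i)) ∧
    ∀ l, T l = ∑ i, z i l • Matrix.vecMulVec (x i) (y i)

end SimDiag

/-! ### The JLV algorithm -/

/-- The first step: the space `S²(U) ∩ span {E_{abcd}}ᗮ`, where `U` is spanned by the input. -/
def stepOneSpace {k : ℕ} (u : Fin k → Mat m n) : Submodule ℝ (Tensor m n) :=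
  symSquare (Submodule.span ℝ (Set.range u)) ⊓ perp (minorSpan m n)

/-- `b` is a basis of the subspace `L`. -/
def IsBasisOf {E : Type} [AddCommGroup E] [Module ℝ E] {k : ℕ} (b : Fin k → E)
    (L : Submodule ℝ E) : Prop :=
  LinearIndependent ℝ b ∧ Submodule.span ℝ (Set.range b) = L

/-- The possible outputs: a certificate that the subspace has no nonzero rank-one matrix, a list
of matrices, or failure. -/
inductive Output (m n : ℕ) : Type where
  | noRankOne : Output m n
  | found (r : ℕ) (vhat : Fin r → Mat m n) : Output m n
  | fail : Output m n

/-- `Run u P g h out`: on the input `u`, when the basis computed in the first step is `P` and the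
random vectors drawn for the simultaneous diagonalization are `g` and `h`, the algorithm can
output `out`. (Order and scaling of the eigenvectors are not prescribed.) -/
inductive Run {k d : ℕ} (u : Fin k → Mat m n) (P : Fin d → Tensor m n) (g h : Fin d → ℝ) :
    Output m n → Prop where
  | certify (hP : IsBasisOf P (stepOneSpace u)) (hd : d = 0) : Run u P g h .noRankOne
  | extract (hP : IsBasisOf P (stepOneSpace u)) (hd : d ≠ 0) (r : ℕ) (z : Fin r → Fin d → ℝ)
      (x y : Fin r → Fin m × Fin n → ℝ) (hdiag : IsSimDiag P g h z x y) :
      Run u P g h (.found r fun i => unvec (x i))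
  | giveUp (hP : IsBasisOf P (stepOneSpace u)) (hd : d ≠ 0)
      (hdiag : ∀ (r : ℕ) (z : Fin r → Fin d → ℝ) (x y : Fin r → Fin m × Fin n → ℝ),
        ¬ IsSimDiag P g h z x y) :
      Run u P g h .fail

/-- The output is right for the subspace `U` with planted matrices `v`: if there are planted
matrices, they are listed up to permutation and nonzero scalars; if there are none, the output is
the certificate, and `U` has indeed no nonzero matrix of rank one. -/
def Output.Succeeds {s : ℕ} (v : Fin s → Mat m n) (U : Submodule ℝ (Mat m n)) :
    Output m n → Prop
  | .noRankOne => s = 0 ∧ ∀ a ∈ U, a ∈ rankOne m n → a = 0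
  | .found r vhat => 0 < s ∧ ∃ (π : Fin r ≃ Fin s) (α : Fin r → ℝ),
      (∀ i, α i ≠ 0) ∧ ∀ i, vhat i = α i • v (π i)
  | .fail => False

end JLV

end

/-!
Write `v i` for the planted and non-planted matrices. Everything rests on one generic fact
(`MinorIndependent`): the products `v i ∨ v j`, except the squares of the planted matrices, are
linearly independent modulo the tensors whose `2 × 2` minors vanish. An element of `S²(U)` is a
symmetric combination of the products, and it is orthogonal to the `E_{abcd}` exactly when its
minors vanish, so the first step then computes the span of the squares of the planted matrices
(`symSquare_inf_perp_eq_span`). Without planted matrices this span is zero, which certifies that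
`U` has no nonzero matrix of rank one, since the square of such a matrix would lie in it.

The generic fact is the injectivity of a matrix with polynomial entries, hence it suffices to
exhibit one point where it holds (`Generic.injective_mulVec`). Place the indices injectively at
positions `(a, j)` with `a < m - 1` and `j < ⌊n / 2⌋`, which is possible because
`R ≤ (m - 1) ⌊n / 2⌋`, and let the matrix at `(a, j)` live in the rows `a + 1` and `0`: its row
`a + 1` is `f_j + a g_j`, for disjoint sets of unit vectors `f_j` and `g_j`, and its row `0` is a
multiple of the same vector if the matrix is planted, with a different factor for each planted
matrix, and `g_j` otherwise. The minors in the rows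
`a + 1 ≠ b + 1` kill the coefficients of pairs of indices in different rows, as the slopes `a` and
`b` differ, and the minors in the rows `0` and `a + 1` kill the remaining ones
(`minorIndependent_of_pattern`).

For the second step, let `X` have the planted matrices as columns. The basis computed in the first
step consists of matrices `X * D * Xᵀ` with `D` diagonal, and so do its contractions `A`, `B`. As
`X` has a left inverse `Y` that is its pseudoinverse, `A * B⁺ = X * D' * Y` for the diagonal matrix
`D'` of ratios, which are nonzero and distinct for generic contractions (`generic_contractions`),
and likewise for `(A⁺ * B)ᵀ`; the eigenvectors are the columns of `X`, up to order and scaling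
(`simDiag_correct`).
-/

namespace JLV

/-! ### Generic properties -/

section Generic

variable {σ : Type}

theorem Generic.and {Q Q' : (σ → ℝ) → Prop} (h : Generic Q) (h' : Generic Q') :
    Generic fun w => Q w ∧ Q' w := by
  obtain ⟨p, hp, hQ⟩ := h
  obtain ⟨p', hp', hQ'⟩ := h'
  refine ⟨p * p', mul_ne_zero hp hp', fun w hw => ?_⟩
  rw [map_mul] at hw
  exact ⟨hQ w (left_ne_zero_of_mul hw), hQ' w (right_ne_zero_of_mul hw)⟩

theorem Generic.mono {Q Q' : (σ → ℝ) → Prop} (h : Generic Q) (hQ : ∀ w, Q w → Q' w) :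
    Generic Q' := by
  obtain ⟨p, hp, hpQ⟩ := h
  exact ⟨p, hp, fun w hw => hQ w (hpQ w hw)⟩

theorem Generic.of_forall {Q : (σ → ℝ) → Prop} (h : ∀ w, Q w) : Generic Q :=
  ⟨1, one_ne_zero, fun w _ => h w⟩

theorem Generic.forall {ι : Type} [Fintype ι] {Q : ι → (σ → ℝ) → Prop}
    (h : ∀ i, Generic (Q i)) : Generic fun w => ∀ i, Q i w := by
  choose p hp hQ using h
  refine ⟨∏ i, p i, Finset.prod_ne_zero_iff.2 fun i _ => hp i, fun w hw i => hQ i w ?_⟩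
  rw [map_prod] at hw
  exact Finset.prod_ne_zero_iff.1 hw i (Finset.mem_univ i)

theorem Generic.eval_ne_zero (p : MvPolynomial σ ℝ) (w₀ : σ → ℝ)
    (h : MvPolynomial.eval w₀ p ≠ 0) : Generic fun w => MvPolynomial.eval w p ≠ 0 :=
  ⟨p, fun h0 => h (by simp [h0]), fun _ hw => hw⟩

/-- Injectivity of a matrix with polynomial entries is a generic property as soon as it holds at
one point: over `ℝ` it is the nonvanishing of the Gram determinant. -/
theorem Generic.injective_mulVec {K J : Type} [Fintype K] [Fintype J]
    (M : Matrix K J (MvPolynomial σ ℝ)) (w₀ : σ → ℝ)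
    (h : Function.Injective (M.map (MvPolynomial.eval w₀)).mulVec) :
    Generic fun w => Function.Injective (M.map (MvPolynomial.eval w)).mulVec := by
  classical
  have gram (w : σ → ℝ) : MvPolynomial.eval w (Mᵀ * M).det =
      ((M.map (MvPolynomial.eval w))ᵀ * M.map (MvPolynomial.eval w)).det := by
    rw [RingHom.map_det, RingHom.mapMatrix_apply, Matrix.map_mul, Matrix.transpose_map]
  refine (Generic.eval_ne_zero (Mᵀ * M).det w₀ ?_).mono fun w hw => ?_
  · rw [gram]
    have := (Matrix.PosDef.conjTranspose_mul_self _ h).det_pos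
    rw [Matrix.conjTranspose_eq_transpose_of_trivial] at this
    exact this.ne'
  · rw [gram] at hw
    have hinj := Matrix.mulVec_injective_of_isUnit
      ((Matrix.isUnit_iff_isUnit_det _).2 (isUnit_iff_ne_zero.2 hw))
    intro a b hab
    apply hinj
    simp only [← Matrix.mulVec_mulVec]
    exact congrArg _ hab

end Generic

/-! ### Simultaneous diagonalization of simultaneously diagonalized slices -/

section SimDiag

variable {ι : Type} {s : ℕ}

theorem IsPseudoinverse.unique [Fintype ι] {κ : Type} [Fintype κ] {A : Matrix ι κ ℝ}
    {B C : Matrix κ ι ℝ}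
    (hB : IsPseudoinverse A B) (hC : IsPseudoinverse A C) : B = C := by
  have h1 : A * B = A * C := by
    calc A * B = (A * B)ᵀ := hB.symm_left.symm
      _ = ((A * C) * (A * B))ᵀ := by
          rw [← Matrix.mul_assoc (A * C) A B, hC.mul_mul_left]
      _ = (A * B) * (A * C) := by rw [Matrix.transpose_mul, hB.symm_left, hC.symm_left]
      _ = A * C := by rw [← Matrix.mul_assoc, hB.mul_mul_left]
  have h2 : B * A = C * A := by
    calc B * A = (B * A)ᵀ := hB.symm_right.symm
      _ = ((B * A) * (C * A))ᵀ := by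
          rw [Matrix.mul_assoc B A (C * A), ← Matrix.mul_assoc A C A, hC.mul_mul_left]
      _ = (C * A) * (B * A) := by rw [Matrix.transpose_mul, hB.symm_right, hC.symm_right]
      _ = C * A := by rw [Matrix.mul_assoc, ← Matrix.mul_assoc A B A, hB.mul_mul_left]
  calc B = B * A * B := hB.mul_mul_right.symm
    _ = C * A * C := by rw [h2, Matrix.mul_assoc, h1, ← Matrix.mul_assoc]
    _ = C := hC.mul_mul_right

/-- If `Y` is a left inverse of `X` whose product `X * Y` is symmetric, that is, if `Y` is the
pseudoinverse of `X`, then `X * D * Xᵀ` has the pseudoinverse `Yᵀ * D⁻¹ * Y`. -/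
theorem isPseudoinverse_congr_diagonal [Fintype ι] {X : Matrix ι (Fin s) ℝ} {Y : Matrix (Fin s) ι ℝ}
    (hYX : Y * X = 1) (hXY : (X * Y)ᵀ = X * Y) {δ : Fin s → ℝ} (hδ : ∀ i, δ i ≠ 0) :
    IsPseudoinverse (X * Matrix.diagonal δ * Xᵀ)
      (Yᵀ * Matrix.diagonal (fun i => (δ i)⁻¹) * Y) := by
  have hYX' : Xᵀ * Yᵀ = 1 := by rw [← Matrix.transpose_mul, hYX, Matrix.transpose_one]
  have hXY' : Yᵀ * Xᵀ = X * Y := by rw [← Matrix.transpose_mul, hXY]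
  have hD : Matrix.diagonal δ * Matrix.diagonal (fun i => (δ i)⁻¹) = 1 := by
    simp [Matrix.diagonal_mul_diagonal, hδ]
  have hD' : Matrix.diagonal (fun i => (δ i)⁻¹) * Matrix.diagonal δ = 1 := by
    simp [Matrix.diagonal_mul_diagonal, hδ]
  have hl : X * Matrix.diagonal δ * Xᵀ * (Yᵀ * Matrix.diagonal (fun i => (δ i)⁻¹) * Y) = X * Y := by
    calc _ = X * (Matrix.diagonal δ * (Xᵀ * Yᵀ) * Matrix.diagonal (fun i => (δ i)⁻¹)) * Y := by
          simp only [Matrix.mul_assoc]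
      _ = X * Y := by rw [hYX', Matrix.mul_one, hD, Matrix.mul_one]
  have hr : Yᵀ * Matrix.diagonal (fun i => (δ i)⁻¹) * Y * (X * Matrix.diagonal δ * Xᵀ) = X * Y := by
    calc _ = Yᵀ * (Matrix.diagonal (fun i => (δ i)⁻¹) * (Y * X) * Matrix.diagonal δ) * Xᵀ := by
          simp only [Matrix.mul_assoc]
      _ = X * Y := by rw [hYX, Matrix.mul_one, hD', Matrix.mul_one, hXY']
  refine ⟨?_, ?_, by rw [hl, hXY], by rw [hr, hXY]⟩
  · rw [hl]
    calc _ = X * (Y * X) * Matrix.diagonal δ * Xᵀ := by simp only [Matrix.mul_assoc]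
      _ = _ := by rw [hYX, Matrix.mul_one]
  · rw [hr]
    calc _ = (X * Y) * Yᵀ * Matrix.diagonal (fun i => (δ i)⁻¹) * Y := by
          simp only [Matrix.mul_assoc]
      _ = _ := by rw [← hXY', Matrix.mul_assoc Yᵀ, hYX', Matrix.mul_one]

/-- If `Y` is a left inverse of `X`, then the eigenvectors of `X * D * Y` for a nonzero
eigenvalue are the images under `X` of those of `D`. -/
theorem exists_eq_mulVec_of_eigen [Fintype ι] {X : Matrix ι (Fin s) ℝ} {Y : Matrix (Fin s) ι ℝ}
    (hYX : Y * X = 1) {δ : Fin s → ℝ} {c : ℝ} (hc : c ≠ 0) {u : ι → ℝ}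
    (hu : (X * Matrix.diagonal δ * Y) *ᵥ u = c • u) :
    ∃ t : Fin s → ℝ, u = X *ᵥ t ∧ ∀ i, δ i ≠ c → t i = 0 := by
  have ht : Matrix.diagonal δ *ᵥ (Y *ᵥ u) = c • (Y *ᵥ u) := by
    have := congrArg (fun v => Y *ᵥ v) hu
    simp only [Matrix.mulVec_smul, Matrix.mulVec_mulVec, ← Matrix.mul_assoc, hYX,
      Matrix.one_mul] at this
    rw [Matrix.mulVec_mulVec, this]
  refine ⟨Y *ᵥ u, ?_, fun i hi => ?_⟩
  · have : c • u = c • (X *ᵥ (Y *ᵥ u)) := by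
      rw [← Matrix.mulVec_smul, ← ht, ← hu]
      simp only [Matrix.mulVec_mulVec, Matrix.mul_assoc]
    exact smul_right_injective _ hc this
  · have := congrFun ht i
    rw [Matrix.mulVec_diagonal, Pi.smul_apply, smul_eq_mul] at this
    exact (mul_eq_mul_right_iff.1 this).resolve_left hi

theorem mulVec_col_eq [Fintype ι] {X : Matrix ι (Fin s) ℝ} {Y : Matrix (Fin s) ι ℝ}
    (hYX : Y * X = 1) (δ : Fin s → ℝ) (i : Fin s) :
    (X * Matrix.diagonal δ * Y) *ᵥ X.col i = δ i • X.col i := by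
  rw [← Matrix.mulVec_single_one, Matrix.mulVec_mulVec, Matrix.mul_assoc, hYX, Matrix.mul_one,
    ← Matrix.mulVec_mulVec, Matrix.diagonal_mulVec_single, mul_one, ← Matrix.mulVec_smul]
  congr 1
  ext j
  by_cases h : j = i <;> simp [h]

theorem col_ne_zero [Fintype ι] {X : Matrix ι (Fin s) ℝ} {Y : Matrix (Fin s) ι ℝ}
    (hYX : Y * X = 1) (i : Fin s) : X.col i ≠ 0 := by
  intro h
  rw [← Matrix.mulVec_single_one] at h
  have := congrArg (fun v => (Y *ᵥ v) i) h
  rw [Matrix.mulVec_mulVec, hYX, Matrix.one_mulVec, Matrix.mulVec_zero] at this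
  simp at this

theorem mulVec_eq_smul_col (X : Matrix ι (Fin s) ℝ) {t : Fin s → ℝ} {i : Fin s}
    (ht : ∀ j, j ≠ i → t j = 0) : X *ᵥ t = t i • X.col i := by
  ext p
  rw [Matrix.mulVec, dotProduct, Finset.sum_eq_single i (fun j _ hj => by simp [ht j hj])
    (by simp)]
  simp [mul_comm]

theorem isEigenList_mul_diagonal_mul [Fintype ι] [DecidableEq ι] {X : Matrix ι (Fin s) ℝ}
    {Y : Matrix (Fin s) ι ℝ}
    (hYX : Y * X = 1) {δ : Fin s → ℝ} (hδ : ∀ i, δ i ≠ 0) (hinj : Function.Injective δ) :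
    IsEigenList (X * Matrix.diagonal δ * Y) δ (fun i => X.col i) where
  injective := hinj
  ne_zero := hδ
  complete := by
    intro c hc hev
    obtain ⟨u, hu⟩ := hev.exists_hasEigenvector
    obtain ⟨t, rfl, ht⟩ := exists_eq_mulVec_of_eigen (u := u) hYX hc
      ((Matrix.toLin'_apply _ _).symm.trans hu.apply_eq_smul)
    by_contra! hne
    exact hu.2 (by rw [show t = 0 from funext fun i => ht i (hne i), Matrix.mulVec_zero])
  vec_ne_zero := col_ne_zero hYX
  eigenspace_eq := by
    intro i
    ext u
    rw [Module.End.mem_eigenspace_iff, Matrix.toLin'_apply, Submodule.mem_span_singleton]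
    constructor
    · intro hu
      obtain ⟨t, rfl, ht⟩ := exists_eq_mulVec_of_eigen hYX (hδ i) hu
      exact ⟨t i, (mulVec_eq_smul_col X fun j hj => ht j (hinj.ne hj)).symm⟩
    · rintro ⟨a, rfl⟩
      rw [Matrix.mulVec_smul, mulVec_col_eq hYX, smul_comm]

/-- Two lists of the nonzero eigenvalues with eigenvectors differ by a permutation and by nonzero
scalars. -/
theorem IsEigenList.unique [Fintype ι] [DecidableEq ι] {M : Matrix ι ι ℝ} {r r' : ℕ}
    {lam : Fin r → ℝ} {x : Fin r → ι → ℝ} {lam' : Fin r' → ℝ} {x' : Fin r' → ι → ℝ}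
    (h : IsEigenList M lam x) (h' : IsEigenList M lam' x') :
    ∃ (π : Fin r ≃ Fin r') (α : Fin r → ℝ), (∀ i, α i ≠ 0) ∧ ∀ i, x i = α i • x' (π i) := by
  have key {r r' : ℕ} {lam : Fin r → ℝ} {x : Fin r → ι → ℝ} {lam' : Fin r' → ℝ}
      {x' : Fin r' → ι → ℝ} (h : IsEigenList M lam x) (h' : IsEigenList M lam' x') (i : Fin r) :
      ∃ j, lam' j = lam i := by
    refine h'.complete _ (h.ne_zero i) (Module.End.hasEigenvalue_of_hasEigenvector
      (x := x i) ⟨?_, h.vec_ne_zero i⟩)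
    exact (h.eigenspace_eq i).ge (Submodule.mem_span_singleton_self (x i))
  choose f hf using key h h'
  choose f' hf' using key h' h
  let π : Fin r ≃ Fin r' :=
    ⟨f, f', fun i => h.injective (by rw [hf', hf]), fun i => h'.injective (by rw [hf, hf'])⟩
  have hx (i : Fin r) : ∃ a : ℝ, a • x' (π i) = x i := by
    rw [← Submodule.mem_span_singleton, ← h'.eigenspace_eq, show lam' (π i) = lam i from hf i,
      h.eigenspace_eq]
    exact Submodule.mem_span_singleton_self _
  choose α hα using hx
  refine ⟨π, α, fun i h0 => h.vec_ne_zero i ?_, fun i => (hα i).symm⟩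
  rw [← hα, h0, zero_smul]

theorem sum_smul_vecMulVec_col (X : Matrix ι (Fin s) ℝ) (δ : Fin s → ℝ) :
    ∑ i, δ i • Matrix.vecMulVec (X.col i) (X.col i) = X * Matrix.diagonal δ * Xᵀ := by
  ext p q
  simp only [Matrix.sum_apply, Matrix.smul_apply, Matrix.vecMulVec_apply, Matrix.col_apply,
    smul_eq_mul, Matrix.mul_apply (N := Xᵀ), Matrix.mul_diagonal, Matrix.transpose_apply]
  exact Finset.sum_congr rfl fun i _ => by ring

/-- Simultaneous diagonalization works for slices `P l` of the form `X * D l * Xᵀ`, where the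
columns of `X` are independent, as soon as the contractions with `g` and `h` have nonzero
coefficients with pairwise distinct ratios. -/
theorem simDiag_correct [Fintype ι] [DecidableEq ι] {X : Matrix ι (Fin s) ℝ}
    (hX : Function.Injective X.mulVec) {d : ℕ}
    {P : Fin d → Matrix ι ι ℝ} {C : Fin d → Fin s → ℝ}
    (hP : ∀ l, P l = ∑ i, C l i • Matrix.vecMulVec (X.col i) (X.col i)) {g h : Fin d → ℝ}
    (hg : ∀ i, ∑ l, g l * C l i ≠ 0) (hh : ∀ i, ∑ l, h l * C l i ≠ 0)
    (hgh : ∀ i j, i ≠ j →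
      (∑ l, g l * C l i) * (∑ l, h l * C l j) ≠ (∑ l, g l * C l j) * ∑ l, h l * C l i) :
    (∃ (z : Fin s → Fin d → ℝ) (x y : Fin s → ι → ℝ), IsSimDiag P g h z x y) ∧
    ∀ (r : ℕ) (z : Fin r → Fin d → ℝ) (x y : Fin r → ι → ℝ), IsSimDiag P g h z x y →
      ∃ (π : Fin r ≃ Fin s) (α : Fin r → ℝ), (∀ i, α i ≠ 0) ∧ ∀ i, x i = α i • X.col (π i) := by
  have contract (g : Fin d → ℝ) :
      ∑ l, g l • P l = X * Matrix.diagonal (fun i => ∑ l, g l * C l i) * Xᵀ := by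
    rw [← sum_smul_vecMulVec_col]
    simp only [hP, Finset.smul_sum, smul_smul, Finset.sum_smul]
    exact Finset.sum_comm
  set a := fun i => ∑ l, g l * C l i with ha
  set b := fun i => ∑ l, h l * C l i with hb
  have hgram : IsUnit (Xᵀ * X).det := by
    have := (Matrix.PosDef.conjTranspose_mul_self X hX).det_pos
    rw [Matrix.conjTranspose_eq_transpose_of_trivial] at this
    exact isUnit_iff_ne_zero.2 this.ne'
  set Y := (Xᵀ * X)⁻¹ * Xᵀ with hY
  have hYX : Y * X = 1 := by rw [hY, Matrix.mul_assoc, Matrix.nonsing_inv_mul _ hgram]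
  have hXY : (X * Y)ᵀ = X * Y := by
    simp [hY, Matrix.transpose_mul, Matrix.transpose_nonsing_inv, Matrix.mul_assoc]
  have hYX' : Xᵀ * Yᵀ = 1 := by rw [← Matrix.transpose_mul, hYX, Matrix.transpose_one]
  have hA := isPseudoinverse_congr_diagonal hYX hXY hg
  have hB := isPseudoinverse_congr_diagonal hYX hXY hh
  have hAB : X * Matrix.diagonal a * Xᵀ * (Yᵀ * Matrix.diagonal (fun i => (b i)⁻¹) * Y) =
      X * Matrix.diagonal (fun i => a i / b i) * Y := by
    calc _ = X * (Matrix.diagonal a * (Xᵀ * Yᵀ) * Matrix.diagonal (fun i => (b i)⁻¹)) * Y := by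
          simp only [Matrix.mul_assoc]
      _ = _ := by
          rw [hYX', Matrix.mul_one, Matrix.diagonal_mul_diagonal]
          simp only [div_eq_mul_inv]
  have hBA : (Yᵀ * Matrix.diagonal (fun i => (a i)⁻¹) * Y * (X * Matrix.diagonal b * Xᵀ))ᵀ =
      X * Matrix.diagonal (fun i => b i / a i) * Y := by
    calc _ = X * (Matrix.diagonal b * (Y * X)ᵀ * Matrix.diagonal (fun i => (a i)⁻¹)) * Y := by
          simp only [Matrix.transpose_mul, Matrix.transpose_transpose, Matrix.diagonal_transpose,
            Matrix.mul_assoc]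
      _ = _ := by
          rw [hYX, Matrix.transpose_one, Matrix.mul_one, Matrix.diagonal_mul_diagonal]
          simp only [div_eq_mul_inv]
  have hinj : Function.Injective fun i => a i / b i := by
    intro i j hij
    by_contra hne
    exact hgh i j hne ((div_eq_div_iff (hh i) (hh j)).1 hij)
  have hinj' : Function.Injective fun i => b i / a i := by
    intro i j hij
    exact hinj (by simpa [inv_div] using congrArg (·⁻¹) hij)
  have hlist := isEigenList_mul_diagonal_mul hYX (fun i => div_ne_zero (hg i) (hh i)) hinj
  constructor
  · refine ⟨fun i l => C l i, fun i => X.col i, fun i => X.col i,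
      Yᵀ * Matrix.diagonal (fun i => (a i)⁻¹) * Y, Yᵀ * Matrix.diagonal (fun i => (b i)⁻¹) * Y,
      fun i => a i / b i, fun i => b i / a i, fun i => X.col i, Equiv.refl _, ?_, ?_, ?_, ?_,
      fun i => ?_, fun i => rfl, hP⟩
    · rw [contract]; exact hA
    · rw [contract]; exact hB
    · rw [contract, hAB]; exact hlist
    · rw [contract, hBA]
      exact isEigenList_mul_diagonal_mul hYX (fun i => div_ne_zero (hh i) (hg i)) hinj'
    · exact (div_mul_div_cancel₀ (hh i)).trans (div_self (hg i))
  · rintro r z x y ⟨A', B', lam, mu, y₀, σ, -, hB', hl, -⟩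
    rw [contract] at hB' hl
    rw [hB'.unique hB, hAB] at hl
    exact hl.unique hlist

end SimDiag

/-! ### The first step of the algorithm -/

section StepOne

variable {m n R s : ℕ}

/-- All the spanning matrices `v^1, …, v^R`: the planted ones, then the non-planted ones. -/
def generator (w : Var m n R s → ℝ) : Fin s ⊕ Fin (R - s) → Mat m n :=
  Sum.elim (planted w) (nonPlanted w)

theorem plantedSubspace_eq_span_generator (w : Var m n R s → ℝ) :
    plantedSubspace w = Submodule.span ℝ (Set.range (generator w)) := by
  rw [plantedSubspace, generator, Set.Sum.elim_range]

/-- The products `v^i ∨ v^j`, with `i ≠ j` or with `v^i = v^j` not planted, are linearly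
independent modulo the tensors whose minors vanish. Instead of choosing one pair from `(i, j)`
and `(j, i)`, this is stated for symmetric coefficients that vanish on the planted diagonal. -/
def MinorIndependent (v : Fin s ⊕ Fin (R - s) → Mat m n) : Prop :=
  ∀ C : Fin s ⊕ Fin (R - s) → Fin s ⊕ Fin (R - s) → ℝ, (∀ i j, C i j = C j i) →
    (∀ i, C (.inl i) (.inl i) = 0) →
    (∀ a b c d, ∑ i, ∑ j, C i j * (v i a b * v j c d - v i a d * v j c b) = 0) →
    ∀ i j, C i j = 0

theorem tensorInner_add_right (T S S' : Tensor m n) :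
    tensorInner T (S + S') = tensorInner T S + tensorInner T S' := by
  simp [tensorInner, mul_add, Finset.sum_add_distrib]

theorem tensorInner_sub_right (T S S' : Tensor m n) :
    tensorInner T (S - S') = tensorInner T S - tensorInner T S' := by
  simp [tensorInner, mul_sub, Finset.sum_sub_distrib]

theorem tensorInner_smul_right (T S : Tensor m n) (c : ℝ) :
    tensorInner T (c • S) = c * tensorInner T S := by
  simp only [tensorInner, Finset.mul_sum, Matrix.smul_apply, smul_eq_mul]
  exact Finset.sum_congr rfl fun _ _ => Finset.sum_congr rfl fun _ _ => by ring

theorem tensorInner_tensorProd_single (T : Tensor m n) (a : Fin m) (b : Fin n) (c : Fin m)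
    (d : Fin n) :
    tensorInner T (tensorProd (Matrix.single a b 1) (Matrix.single c d 1)) = T (a, b) (c, d) := by
  rw [tensorInner, Finset.sum_eq_single (a, b), Finset.sum_eq_single (c, d)]
  · simp [tensorProd, vec, Matrix.vecMulVec_apply]
  · rintro ⟨c', d'⟩ - h
    have : ¬ (c = c' ∧ d = d') := fun h' => h (by rw [h'.1, h'.2])
    simp [tensorProd, vec, Matrix.vecMulVec_apply, this]
  · simp
  · rintro ⟨c', d'⟩ - h
    have : ¬ (a = c' ∧ b = d') := fun h' => h (by rw [h'.1, h'.2])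
    simp [tensorProd, vec, Matrix.vecMulVec_apply, this]
  · simp

theorem tensorInner_minorTensor {T : Tensor m n} (hT : ∀ p q, T p q = T q p) (a : Fin m)
    (b : Fin n) (c : Fin m) (d : Fin n) :
    tensorInner T (minorTensor a b c d) = T (a, b) (c, d) - T (a, d) (c, b) := by
  simp only [minorTensor, sprod, tensorInner_sub_right, tensorInner_add_right,
    tensorInner_smul_right, tensorInner_tensorProd_single]
  rw [hT (c, d), hT (c, b)]
  ring

/-- A symmetric tensor is orthogonal to the tensors `E_{abcd}` with `a < c` and `b < d` if and
only if all of its minors vanish: the other minors are zero or differ by a sign. -/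
theorem mem_perp_minorSpan_iff {T : Tensor m n} (hT : ∀ p q, T p q = T q p) :
    T ∈ perp (minorSpan m n) ↔ ∀ a b c d, T (a, b) (c, d) = T (a, d) (c, b) := by
  constructor
  · intro h
    have h1 (a b c d) (hac : a < c) (hbd : b < d) : T (a, b) (c, d) = T (a, d) (c, b) := by
      have := h _ (Submodule.subset_span ⟨a, c, b, d, hac, hbd, rfl⟩)
      rw [tensorInner_minorTensor hT] at this
      exact sub_eq_zero.1 this
    have h2 (a b c d) (hac : a < c) : T (a, b) (c, d) = T (a, d) (c, b) := by
      rcases lt_trichotomy b d with hbd | rfl | hbd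
      · exact h1 a b c d hac hbd
      · rfl
      · exact (h1 a d c b hac hbd).symm
    intro a b c d
    rcases lt_trichotomy a c with hac | rfl | hac
    · exact h2 a b c d hac
    · exact hT _ _
    · rw [hT, h2 c d a b hac, hT]
  · intro h S hS
    refine Submodule.span_induction (p := fun S _ => tensorInner T S = 0) ?_ ?_ ?_ ?_ hS
    · rintro _ ⟨a, c, b, d, -, -, rfl⟩
      rw [tensorInner_minorTensor hT, h, sub_self]
    · simp [tensorInner]
    · intro x y _ _ hx hy
      rw [tensorInner_add_right, hx, hy, add_zero]
    · intro c x _ hx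
      rw [tensorInner_smul_right, hx, mul_zero]

/-- The elements of `S²(U)` are the symmetric combinations of the tensors `v i ⊗ v j`, for a
family `v` that spans `U`. -/
theorem exists_symm_coeff_of_mem_symSquare {J : Type} [Fintype J] {v : J → Mat m n}
    {T : Tensor m n} (hT : T ∈ symSquare (Submodule.span ℝ (Set.range v))) :
    ∃ C : J → J → ℝ, (∀ i j, C i j = C j i) ∧
      ∀ p q, T p q = ∑ i, ∑ j, C i j * (v i p.1 p.2 * v j q.1 q.2) := by
  refine Submodule.span_induction (p := fun T _ => ∃ C : J → J → ℝ, (∀ i j, C i j = C j i) ∧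
      ∀ p q, T p q = ∑ i, ∑ j, C i j * (v i p.1 p.2 * v j q.1 q.2)) ?_ ?_ ?_ ?_ hT
  · rintro _ ⟨u, hu, u', hu', rfl⟩
    obtain ⟨a, rfl⟩ := (Submodule.mem_span_range_iff_exists_fun ℝ).1 hu
    obtain ⟨b, rfl⟩ := (Submodule.mem_span_range_iff_exists_fun ℝ).1 hu'
    refine ⟨fun i j => 1 / 2 * (a i * b j + b i * a j), fun i j => by ring, fun p q => ?_⟩
    simp only [sprod, tensorProd, vec, Matrix.add_apply, Matrix.smul_apply,
      Matrix.vecMulVec_apply, Matrix.sum_apply, smul_eq_mul, Finset.sum_mul_sum]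
    simp only [Finset.mul_sum, ← Finset.sum_add_distrib]
    exact Finset.sum_congr rfl fun _ _ => Finset.sum_congr rfl fun _ _ => by ring
  · exact ⟨0, by simp, by simp⟩
  · rintro T T' _ _ ⟨C, hC, hT⟩ ⟨C', hC', hT'⟩
    refine ⟨C + C', fun i j => by simp [hC i j, hC' i j], fun p q => ?_⟩
    simp [hT, hT', add_mul, Finset.sum_add_distrib]
  · rintro c T _ ⟨C, hC, hT⟩
    refine ⟨c • C, fun i j => by simp [hC i j], fun p q => ?_⟩
    simp [hT, Finset.mul_sum, mul_assoc]

theorem sprod_self (u : Mat m n) : sprod u u = tensorProd u u := by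
  rw [sprod, ← add_smul]
  norm_num

/-- The square `v ⊗ v` of a matrix of rank one in `U` lies in the space computed by the first
step. -/
theorem tensorProd_self_mem {U : Submodule ℝ (Mat m n)} {v : Mat m n} (hv : v ∈ U)
    (h : v ∈ rankOne m n) : tensorProd v v ∈ symSquare U ⊓ perp (minorSpan m n) := by
  refine ⟨Submodule.subset_span ⟨v, hv, v, hv, (sprod_self v).symm⟩,
    (mem_perp_minorSpan_iff fun p q => ?_).2 ?_⟩
  · simp only [tensorProd, Matrix.vecMulVec_apply, mul_comm]
  · obtain ⟨x, y, rfl⟩ := h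
    intro a b c d
    simp only [tensorProd, vec, Matrix.vecMulVec_apply]
    ring

theorem planted_mem_rankOne (w : Var m n R s → ℝ) (i : Fin s) : planted w i ∈ rankOne m n :=
  ⟨_, _, rfl⟩

/-- Generically, the first step isolates the squares of the planted matrices. -/
theorem symSquare_inf_perp_eq_span {w : Var m n R s → ℝ} (hw : MinorIndependent (generator w)) :
    symSquare (plantedSubspace w) ⊓ perp (minorSpan m n) =
      Submodule.span ℝ (Set.range fun i => tensorProd (planted w i) (planted w i)) := by
  apply le_antisymm
  · rintro T ⟨hT, hperp⟩
    rw [plantedSubspace_eq_span_generator] at hT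
    obtain ⟨C, hC, hTC⟩ := exists_symm_coeff_of_mem_symSquare hT
    have hsymm (p q) : T p q = T q p := by
      rw [hTC, hTC, Finset.sum_comm]
      exact Finset.sum_congr rfl fun i _ => Finset.sum_congr rfl fun j _ => by rw [hC]; ring
    rw [SetLike.mem_coe, mem_perp_minorSpan_iff hsymm] at hperp
    -- Removing the planted diagonal of `C` does not change the minors.
    let D : Fin s ⊕ Fin (R - s) → Fin s ⊕ Fin (R - s) → ℝ := fun i j =>
      if i = j then Sum.elim (fun i => C (.inl i) (.inl i)) 0 i else 0
    have hsumD (F : Fin s ⊕ Fin (R - s) → Fin s ⊕ Fin (R - s) → ℝ) :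
        ∑ i, ∑ j, D i j * F i j = ∑ i, C (.inl i) (.inl i) * F (.inl i) (.inl i) := by
      simp [D, Fintype.sum_sum_type]
    have hCD : ∀ i j, C i j - D i j = 0 := by
      refine hw (fun i j => C i j - D i j) (fun i j => ?_) (fun i => by simp [D])
        (fun a b c d => ?_)
      · by_cases hij : i = j
        · rw [hij]
        · simp [D, hij, Ne.symm hij, hC i j]
      · have h1 := hperp a b c d
        rw [hTC, hTC, ← sub_eq_zero, ← Finset.sum_sub_distrib] at h1
        simp only [← Finset.sum_sub_distrib, ← mul_sub] at h1
        simp only [sub_mul, Finset.sum_sub_distrib]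
        rw [hsumD, h1, zero_sub, neg_eq_zero]
        refine Finset.sum_eq_zero fun i _ => ?_
        simp only [generator, Sum.elim_inl, planted, Matrix.vecMulVec_apply]
        ring
    have hT' : T = ∑ i, C (.inl i) (.inl i) • tensorProd (planted w i) (planted w i) := by
      ext p q
      rw [hTC, Finset.sum_congr rfl fun i _ => Finset.sum_congr rfl fun j _ => by
        rw [sub_eq_zero.1 (hCD i j)], hsumD]
      simp [Matrix.sum_apply, tensorProd, vec, Matrix.vecMulVec_apply, generator]
    rw [hT']
    exact Submodule.sum_mem _ fun i _ =>
      Submodule.smul_mem _ _ (Submodule.subset_span ⟨i, rfl⟩)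
  · rw [Submodule.span_le]
    rintro _ ⟨i, rfl⟩
    exact tensorProd_self_mem (Submodule.subset_span (.inl ⟨i, rfl⟩)) (planted_mem_rankOne w i)

/-- The `mn × s` matrix whose columns are the coordinate vectors of the planted matrices. -/
def plantedMatrix (w : Var m n R s → ℝ) : Matrix (Fin m × Fin n) (Fin s) ℝ :=
  Matrix.of fun p i => planted w i p.1 p.2

theorem col_plantedMatrix (w : Var m n R s → ℝ) (i : Fin s) :
    (plantedMatrix w).col i = vec (planted w i) := rfl

theorem linearIndependent_tensorProd_self {w : Var m n R s → ℝ}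
    (hX : Function.Injective (plantedMatrix w).mulVec) :
    LinearIndependent ℝ fun i => tensorProd (planted w i) (planted w i) := by
  have hcol : LinearIndependent ℝ (plantedMatrix w).col := Matrix.mulVec_injective_iff.1 hX
  have hne := hcol.ne_zero
  rw [Fintype.linearIndependent_iff] at hcol ⊢
  intro c hc i
  -- Each column of `∑ i, c i • (v i) (v i)ᵀ` is a combination of the `v i`.
  have hq (q) : c i * vec (planted w i) q = 0 := by
    refine hcol (fun i => c i * vec (planted w i) q) ?_ i
    ext p
    have := congrFun (congrFun hc p) q
    simp only [Matrix.sum_apply, Matrix.smul_apply, tensorProd, Matrix.vecMulVec_apply,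
      smul_eq_mul, Matrix.zero_apply] at this
    simp only [Finset.sum_apply, Pi.smul_apply, smul_eq_mul, Pi.zero_apply, col_plantedMatrix]
    rw [← this]
    exact Finset.sum_congr rfl fun _ _ => by ring
  by_contra hci
  refine hne i (funext fun q => ?_)
  exact (mul_eq_zero.1 (hq q)).resolve_left hci

end StepOne

/-! ### Generic independence of the minors -/

section MinorIndependent

variable {m n R s k : ℕ}

/-- A sufficient condition for the independence of the minors. The index `i` is placed at the
position `e i = (a, j)`; below the row `0`, the matrix `v i` has only the row `a`, with entries `1`
in column `f j` and `a` in column `g j`; in the row `0` it has entries `τ i` in column `f j` and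
`a * τ i + γ i` in column `g j`. -/
theorem minorIndependent_of_pattern {v : Fin s ⊕ Fin (R - s) → Mat (m + 1) n}
    {e : Fin s ⊕ Fin (R - s) → Fin m × Fin k} (he : Function.Injective e) {f g : Fin k → Fin n}
    {τ γ : Fin s ⊕ Fin (R - s) → ℝ}
    (hτ : Function.Injective fun i => τ (.inl i)) (hγ : ∀ i, γ (.inr i) ≠ 0)
    (hf : ∀ i a j, v i (Fin.succ a) (f j) = if e i = (a, j) then 1 else 0)
    (hg : ∀ i a j, v i (Fin.succ a) (g j) = (a : ℝ) * v i (Fin.succ a) (f j))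
    (hf₀ : ∀ i j, v i 0 (f j) = if (e i).2 = j then τ i else 0)
    (hg₀ : ∀ i j, v i 0 (g j) = if (e i).2 = j then (e i).1 * τ i + γ i else 0) :
    MinorIndependent v := by
  intro C hC hdiag hminor
  set G : Fin (m + 1) → Fin n → Fin (m + 1) → Fin n → ℝ := fun a p c q =>
    ∑ i, ∑ j, C i j * (v i a p * v j c q) with hG
  have hswap (a p c q) : G a p c q = G a q c p := by
    rw [← sub_eq_zero, ← hminor a p c q]
    simp only [hG, mul_sub, Finset.sum_sub_distrib]
  have hone (i) : v i (Fin.succ (e i).1) (f (e i).2) = 1 := by rw [hf]; simp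
  have hzero {i j} (h : j ≠ i) : v j (Fin.succ (e i).1) (f (e i).2) = 0 := by
    rw [hf, if_neg fun h' => h (he (by simpa using h'))]
  have hleft (i c q) : G (Fin.succ (e i).1) (f (e i).2) c q = ∑ j, C i j * v j c q := by
    simp only [hG]
    rw [Finset.sum_eq_single i (fun j _ hj => by simp [hzero hj]) (by simp)]
    simp [hone]
  have hleft_g (a j c q) : G (Fin.succ a) (g j) c q = a * G (Fin.succ a) (f j) c q := by
    simp only [hG, hg, Finset.mul_sum]
    exact Finset.sum_congr rfl fun _ _ => Finset.sum_congr rfl fun _ _ => by ring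
  have hright_g (a j c q) : G c q (Fin.succ a) (g j) = a * G c q (Fin.succ a) (f j) := by
    simp only [hG, hg, Finset.mul_sum]
    exact Finset.sum_congr rfl fun _ _ => Finset.sum_congr rfl fun _ _ => by ring
  -- Indices placed in different rows `a ≠ b`: the slopes `a` and `b` differ.
  have hrow (i j) (h : (e i).1 ≠ (e j).1) : C i j = 0 := by
    have h0 : G (Fin.succ (e i).1) (f (e i).2) (Fin.succ (e j).1) (f (e j).2) = C i j := by
      rw [hleft, Finset.sum_eq_single j (fun l _ hl => by simp [hzero hl]) (by simp), hone,
        mul_one]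
    have h1 := hswap (Fin.succ (e i).1) (f (e i).2) (Fin.succ (e j).1) (f (e j).2)
    have h2 := hswap (Fin.succ (e i).1) (f (e i).2) (Fin.succ (e j).1) (g (e j).2)
    rw [hright_g, hleft_g, ← h1, h0] at h2
    refine (mul_eq_mul_right_iff.1 h2).resolve_left fun h3 => h ?_
    exact Fin.ext (by exact_mod_cast h3.symm)
  -- Indices placed in the same row: compare with the row `0`.
  have hsame (i j) (h : (e i).1 = (e j).1) : C i j * γ j = 0 ∧ C i j * τ j = C i j * τ i := by
    have hcol {i j l} (h : (e i).1 = (e j).1) (hl : l ≠ j) (hl' : (e l).2 = (e j).2) :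
        C i l = 0 :=
      hrow i l fun h' => hl (he (Prod.ext (h'.symm.trans h) hl'))
    have hf' {i j} (h : (e i).1 = (e j).1) :
        G (Fin.succ (e i).1) (f (e i).2) 0 (f (e j).2) = C i j * τ j := by
      rw [hleft, Finset.sum_eq_single j (fun l _ hl => ?_) (by simp), hf₀, if_pos rfl]
      rw [hf₀]
      split_ifs with hl'
      · rw [hcol h hl hl', zero_mul]
      · rw [mul_zero]
    have hg' {i j} (h : (e i).1 = (e j).1) :
        G (Fin.succ (e i).1) (f (e i).2) 0 (g (e j).2) = C i j * ((e j).1 * τ j + γ j) := by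
      rw [hleft, Finset.sum_eq_single j (fun l _ hl => ?_) (by simp), hg₀, if_pos rfl]
      rw [hg₀]
      split_ifs with hl'
      · rw [hcol h hl hl', zero_mul]
      · rw [mul_zero]
    have h1 := hswap (Fin.succ (e i).1) (f (e i).2) 0 (f (e j).2)
    have h2 := hswap (Fin.succ (e i).1) (f (e i).2) 0 (g (e j).2)
    rw [hleft_g, hg' h, h, hf' h.symm] at h2
    rw [hf' h, h, hf' h.symm] at h1
    rw [← h1] at h2
    refine ⟨by linear_combination h2, by rw [h1, hC]⟩
  have hinr (i j) : C i (.inr j) = 0 := by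
    by_cases h : (e i).1 = (e (.inr j)).1
    · exact (mul_eq_zero.1 (hsame i _ h).1).resolve_right (hγ j)
    · exact hrow i _ h
  rintro (i | i) (j | j)
  · by_cases hij : i = j
    · rw [hij, hdiag]
    · by_cases h : (e (.inl i)).1 = (e (.inl j)).1
      · exact (mul_eq_mul_left_iff.1 (hsame _ _ h).2).resolve_left fun h' => hij (hτ h'.symm)
      · exact hrow _ _ h
  · exact hinr _ _
  · rw [hC, hinr]
  · exact hinr _ _

/-- The point at which the minors are independent: `x = e_{a+1} + i e_0` and `y = f_j + a g_j` for
the planted matrix number `i`, and `z = e_{a+1} (f_j + a g_j)ᵀ + e_0 g_jᵀ` for the non-planted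
ones, where `(a, j)` is the position that `e` assigns to the index, and `f_j`, `g_j` are the unit
vectors with the numbers `f j` and `g j`. -/
noncomputable def patternPoint (e : Fin s ⊕ Fin (R - s) → Fin m × Fin k) (f g : Fin k → Fin n) :
    Var (m + 1) n R s → ℝ :=
  let y : Fin m × Fin k → Fin n → ℝ := fun p =>
    Pi.single (f p.2) 1 + Pi.single (g p.2) (p.1 : ℝ)
  Sum.elim
    (fun q => (Pi.single (e (.inl q.1)).1.succ 1 + Pi.single 0 (q.1 : ℝ) : Fin (m + 1) → ℝ) q.2)
    (Sum.elim (fun q => y (e (.inl q.1)) q.2)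
      fun q => (Pi.single (e (.inr q.1)).1.succ 1 : Fin (m + 1) → ℝ) q.2.1 *
          y (e (.inr q.1)) q.2.2 +
        (Pi.single 0 1 : Fin (m + 1) → ℝ) q.2.1 *
          (Pi.single (g (e (.inr q.1)).2) 1 : Fin n → ℝ) q.2.2)

theorem generator_patternPoint (e : Fin s ⊕ Fin (R - s) → Fin m × Fin k) (f g : Fin k → Fin n)
    (i : Fin s ⊕ Fin (R - s)) (a : Fin (m + 1)) (b : Fin n) :
    generator (patternPoint e f g) i a b =
      (if a = (e i).1.succ then 1 else 0) *
        ((if b = f (e i).2 then 1 else 0) + if b = g (e i).2 then ((e i).1 : ℝ) else 0) +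
      (if a = 0 then 1 else 0) * (Sum.elim (fun i : Fin s => (i : ℝ)) (fun _ => 0) i *
        ((if b = f (e i).2 then 1 else 0) + if b = g (e i).2 then ((e i).1 : ℝ) else 0) +
        Sum.elim (fun _ : Fin s => (0 : ℝ)) (fun _ => 1) i * if b = g (e i).2 then 1 else 0) := by
  rcases i with i | i
  · simp only [generator, Sum.elim_inl, planted, patternPoint, Sum.elim_inr,
      Matrix.vecMulVec_apply, Pi.add_apply, Pi.single_apply]
    split_ifs <;> ring
  · simp only [generator, nonPlanted, patternPoint, Sum.elim_inr, Matrix.of_apply,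
      Pi.add_apply, Pi.single_apply]
    ring

theorem exists_minorIndependent (hm : 2 ≤ m) (hs : s ≤ R) (hR : R ≤ (m - 1) * (n / 2)) :
    ∃ w : Var m n R s → ℝ, MinorIndependent (generator w) ∧
      Function.Injective (plantedMatrix w).mulVec := by
  obtain ⟨m, rfl⟩ : ∃ m', m = m' + 1 := ⟨m - 1, by omega⟩
  obtain ⟨e⟩ : Nonempty (Fin s ⊕ Fin (R - s) ↪ Fin m × Fin (n / 2)) := by
    refine Function.Embedding.nonempty_of_card_le ?_
    simp only [Fintype.card_sum, Fintype.card_fin, Fintype.card_prod]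
    simpa [Nat.add_sub_cancel' hs] using hR
  let f : Fin (n / 2) → Fin n := fun j => ⟨j, by omega⟩
  let g : Fin (n / 2) → Fin n := fun j => ⟨n / 2 + j, by omega⟩
  have hff (i j : Fin (n / 2)) : f i = f j ↔ i = j := by simp [f, Fin.ext_iff]
  have hgg (i j : Fin (n / 2)) : g i = g j ↔ i = j := by simp [g, Fin.ext_iff]
  have hfg (i j : Fin (n / 2)) : f i ≠ g j := by
    simp only [f, g, ne_eq, Fin.ext_iff]; omega
  have hf (i a j) : generator (patternPoint e f g) i (Fin.succ a) (f j) =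
      if e i = (a, j) then 1 else 0 := by
    simp only [generator_patternPoint, Fin.succ_inj, hff, hfg, Fin.succ_ne_zero, if_false,
      add_zero, zero_mul, Prod.ext_iff]
    simp only [@eq_comm _ a, @eq_comm _ j]
    by_cases h1 : (e i).1 = a <;> by_cases h2 : (e i).2 = j <;> simp [h1, h2]
  have hg (i a j) : generator (patternPoint e f g) i (Fin.succ a) (g j) =
      (a : ℝ) * generator (patternPoint e f g) i (Fin.succ a) (f j) := by
    simp only [generator_patternPoint, Fin.succ_inj, hff, hgg, hfg, (hfg _ _).symm,
      Fin.succ_ne_zero, if_false, add_zero, zero_add, zero_mul]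
    split_ifs <;> simp_all
  refine ⟨patternPoint e f g, minorIndependent_of_pattern e.injective (f := f) (g := g)
    (τ := Sum.elim (fun i : Fin s => (i : ℝ)) (fun _ => 0))
    (γ := Sum.elim (fun _ : Fin s => (0 : ℝ)) (fun _ => 1)) ?_ (by simp) hf hg ?_ ?_, ?_⟩
  · intro i j h
    exact Fin.ext (by simpa using h)
  · intro i j
    simp [generator_patternPoint, hff, hfg, (Fin.succ_ne_zero _).symm, eq_comm]
  · intro i j
    simp only [generator_patternPoint, hgg, (hfg _ _).symm, (Fin.succ_ne_zero _).symm, if_false,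
      if_true, zero_mul, zero_add, one_mul, @eq_comm _ j]
    split_ifs <;> ring
  · rw [Matrix.mulVec_injective_iff, Fintype.linearIndependent_iff]
    intro c hc i
    have hf' (l : Fin s) : plantedMatrix (patternPoint e f g)
        (Fin.succ (e (.inl i)).1, f (e (.inl i)).2) l = if l = i then 1 else 0 :=
      (hf (.inl l) _ _).trans (if_congr (by simp) rfl rfl)
    simpa [Finset.sum_apply, hf'] using congrFun hc (Fin.succ (e (.inl i)).1, f (e (.inl i)).2)

end MinorIndependent

section GenericInput

variable {m n R s : ℕ}

/-- The entries of the matrices `v^1, …, v^R` as polynomials in the variables. -/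
noncomputable def generatorPoly (m n R s : ℕ) (i : Fin s ⊕ Fin (R - s)) (a : Fin m) (b : Fin n) :
    MvPolynomial (Var m n R s) ℝ :=
  Sum.elim (fun i => .X (.inl (i, a)) * .X (.inr (.inl (i, b))))
    (fun i => .X (.inr (.inr (i, a, b)))) i

theorem eval_generatorPoly (w : Var m n R s → ℝ) (i : Fin s ⊕ Fin (R - s)) (a : Fin m)
    (b : Fin n) : MvPolynomial.eval w (generatorPoly m n R s i a b) = generator w i a b := by
  rcases i with i | i <;>
    simp [generatorPoly, generator, planted, nonPlanted, Matrix.vecMulVec_apply]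

/-- The linear system that defines `MinorIndependent`: the rows are the equations for the
coefficients `C i j`, namely the vanishing of the minors, the symmetry, and the vanishing on the
planted diagonal. -/
noncomputable def minorSystem (m n R s : ℕ) :
    Matrix ((Fin m × Fin n × Fin m × Fin n) ⊕
        ((Fin s ⊕ Fin (R - s)) × (Fin s ⊕ Fin (R - s))) ⊕ Fin s)
      ((Fin s ⊕ Fin (R - s)) × (Fin s ⊕ Fin (R - s))) (MvPolynomial (Var m n R s) ℝ) :=
  Matrix.of fun eq p => Sum.elim
    (fun q => generatorPoly m n R s p.1 q.1 q.2.1 * generatorPoly m n R s p.2 q.2.2.1 q.2.2.2 -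
      generatorPoly m n R s p.1 q.1 q.2.2.2 * generatorPoly m n R s p.2 q.2.2.1 q.2.1)
    (Sum.elim (fun q => (if p = q then 1 else 0) - if p = q.swap then 1 else 0)
      fun i => if p = (.inl i, .inl i) then 1 else 0) eq

theorem injective_minorSystem_iff (w : Var m n R s → ℝ) :
    Function.Injective ((minorSystem m n R s).map (MvPolynomial.eval w)).mulVec ↔
      MinorIndependent (generator w) := by
  have hsys (C : (Fin s ⊕ Fin (R - s)) × (Fin s ⊕ Fin (R - s)) → ℝ) :
      (minorSystem m n R s).map (MvPolynomial.eval w) *ᵥ C = 0 ↔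
        (∀ a b c d, ∑ i, ∑ j, C (i, j) *
          (generator w i a b * generator w j c d - generator w i a d * generator w j c b) = 0) ∧
        (∀ i j, C (i, j) = C (j, i)) ∧ ∀ i, C (.inl i, .inl i) = 0 := by
    rw [funext_iff, Sum.forall, Sum.forall]
    refine and_congr ?_ (and_congr ?_ ?_)
    · simp [Prod.forall, minorSystem, Matrix.mulVec, dotProduct, eval_generatorPoly,
        Fintype.sum_prod_type, mul_comm]
    · simp [Prod.forall, minorSystem, Matrix.mulVec, dotProduct, sub_mul,
        Finset.sum_sub_distrib, sub_eq_zero, apply_ite (MvPolynomial.eval w)]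
    · simp [minorSystem, Matrix.mulVec, dotProduct, apply_ite (MvPolynomial.eval w)]
  rw [← Matrix.coe_mulVecLin, injective_iff_map_eq_zero]
  simp only [Matrix.mulVecLin_apply, hsys]
  constructor
  · intro h C hC hdiag hminor i j
    exact congrFun (h (fun p => C p.1 p.2) ⟨hminor, hC, hdiag⟩) (i, j)
  · rintro h C ⟨hminor, hC, hdiag⟩
    ext ⟨i, j⟩
    exact h (fun i j => C (i, j)) hC hdiag hminor i j

theorem generic_minorIndependent (hm : 2 ≤ m) (hs : s ≤ R) (hR : R ≤ (m - 1) * (n / 2)) :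
    Generic fun w : Var m n R s → ℝ =>
      MinorIndependent (generator w) ∧ Function.Injective (plantedMatrix w).mulVec := by
  obtain ⟨w₀, h₁, h₂⟩ := exists_minorIndependent (n := n) hm hs hR
  refine Generic.and ?_ ?_
  · exact (Generic.injective_mulVec _ w₀ ((injective_minorSystem_iff w₀).2 h₁)).mono
      fun w => (injective_minorSystem_iff w).1
  · have hX (w : Var m n R s → ℝ) : (Matrix.of fun (p : Fin m × Fin n) i =>
        generatorPoly m n R s (.inl i) p.1 p.2).map (MvPolynomial.eval w) = plantedMatrix w := by
      ext p i
      exact eval_generatorPoly w (.inl i) p.1 p.2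
    exact (Generic.injective_mulVec _ w₀ (by rwa [hX])).mono fun w hw => by rwa [hX] at hw

/-! ### Correctness of the algorithm -/

/-- Generic contractions of independent slices with diagonals `C l` have nonzero coefficients with
pairwise distinct ratios. -/
theorem generic_contractions {d : ℕ} {C : Matrix (Fin d) (Fin s) ℝ}
    (hC : Function.Surjective C.vecMul) :
    Generic fun gh : Fin d ⊕ Fin d → ℝ =>
      (∀ i, ∑ l, gh (.inl l) * C l i ≠ 0) ∧ (∀ i, ∑ l, gh (.inr l) * C l i ≠ 0) ∧
      ∀ i j, i ≠ j →
        (∑ l, gh (.inl l) * C l i) * (∑ l, gh (.inr l) * C l j) ≠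
          (∑ l, gh (.inl l) * C l j) * ∑ l, gh (.inr l) * C l i := by
  let p : Fin s → MvPolynomial (Fin d ⊕ Fin d) ℝ := fun i => ∑ l, .X (.inl l) * .C (C l i)
  let q : Fin s → MvPolynomial (Fin d ⊕ Fin d) ℝ := fun i => ∑ l, .X (.inr l) * .C (C l i)
  have hp (gh i) : MvPolynomial.eval gh (p i) = ∑ l, gh (.inl l) * C l i := by simp [p]
  have hq (gh i) : MvPolynomial.eval gh (q i) = ∑ l, gh (.inr l) * C l i := by simp [q]
  choose t ht using fun i => hC (Pi.single i 1)
  have ht' (i j) : ∑ l, t i l * C l j = (Pi.single i 1 : Fin s → ℝ) j := congrFun (ht i) j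
  refine Generic.and (Generic.forall fun i => ?_) (Generic.and (Generic.forall fun i => ?_)
    (Generic.forall fun i => Generic.forall fun j => ?_))
  · simp only [← hp]
    exact Generic.eval_ne_zero _ (Sum.elim (t i) 0) (by simp [hp, ht'])
  · simp only [← hq]
    exact Generic.eval_ne_zero _ (Sum.elim 0 (t i)) (by simp [hq, ht'])
  · by_cases hij : i = j
    · exact Generic.of_forall fun _ h => absurd hij h
    · refine (Generic.eval_ne_zero (p i * q j - p j * q i) (Sum.elim (t i) (t j)) ?_).mono
        fun gh h _ => ?_
      · simp [hp, hq, ht', hij, Ne.symm hij]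
      · simpa only [map_sub, map_mul, hp, hq, sub_ne_zero] using h

theorem unvec_smul_vec (c : ℝ) (v : Mat m n) : unvec (c • vec v) = c • v := rfl

theorem generic_run_succeeds {w : Var m n R s → ℝ} (hw : MinorIndependent (generator w))
    (hX : Function.Injective (plantedMatrix w).mulVec) {k : ℕ} {u : Fin k → Mat m n}
    (hu : IsBasisOf u (plantedSubspace w)) {d : ℕ} {P : Fin d → Tensor m n}
    (hP : IsBasisOf P (stepOneSpace u)) :
    Generic fun gh : Fin d ⊕ Fin d → ℝ =>
      (∃ out, Run u P (fun l => gh (.inl l)) (fun l => gh (.inr l)) out) ∧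
      ∀ out, Run u P (fun l => gh (.inl l)) (fun l => gh (.inr l)) out →
        out.Succeeds (planted w) (plantedSubspace w) := by
  have hspan : stepOneSpace u =
      Submodule.span ℝ (Set.range fun i => tensorProd (planted w i) (planted w i)) := by
    rw [stepOneSpace, hu.2, symSquare_inf_perp_eq_span hw]
  have hV := linearIndependent_tensorProd_self hX
  have hds : d = s := by
    have h1 := finrank_span_eq_card hP.1
    rw [hP.2, hspan, finrank_span_eq_card hV] at h1
    simpa using h1.symm
  rcases Nat.eq_zero_or_pos s with hs | hs
  · subst hds
    refine Generic.of_forall fun gh => ⟨⟨_, .certify hP hs⟩, fun out hout => ?_⟩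
    cases hout with
    | certify =>
      refine ⟨hs, fun a ha hrank => ?_⟩
      have h := tensorProd_self_mem ha hrank
      subst hs
      rw [symSquare_inf_perp_eq_span hw, Set.range_eq_empty, Submodule.span_empty,
        Submodule.mem_bot] at h
      ext b c
      simpa [tensorProd, vec, Matrix.vecMulVec_apply] using
        congrFun (congrFun h (b, c)) (b, c)
    | extract _ hd => exact absurd hs hd
    | giveUp _ hd => exact absurd hs hd
  · have hd : d ≠ 0 := by omega
    -- The coefficients of the computed basis with respect to the squares of the planted matrices.
    have hcoeff (l : Fin d) : ∃ c : Fin s → ℝ,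
        ∑ i, c i • tensorProd (planted w i) (planted w i) = P l := by
      rw [← Submodule.mem_span_range_iff_exists_fun, ← hspan, ← hP.2]
      exact Submodule.subset_span ⟨l, rfl⟩
    choose C hC using hcoeff
    have hsurj : Function.Surjective (Matrix.of C).vecMul := by
      intro t
      have ht : ∑ i, t i • tensorProd (planted w i) (planted w i) ∈
          Submodule.span ℝ (Set.range P) := by
        rw [hP.2, hspan]
        exact Submodule.sum_mem _ fun i _ =>
          Submodule.smul_mem _ _ (Submodule.subset_span ⟨i, rfl⟩)
      obtain ⟨a, ha⟩ := (Submodule.mem_span_range_iff_exists_fun ℝ).1 ht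
      refine ⟨a, ?_⟩
      simp only [← hC, Finset.smul_sum, smul_smul] at ha
      rw [Finset.sum_comm] at ha
      simp only [← Finset.sum_smul] at ha
      rw [← sub_eq_zero, ← Finset.sum_sub_distrib] at ha
      simp only [← sub_smul] at ha
      ext i
      exact sub_eq_zero.1 (Fintype.linearIndependent_iff.1 hV _ ha i)
    refine (generic_contractions hsurj).mono fun gh hgh => ?_
    obtain ⟨⟨z, x, y, hxy⟩, huniq⟩ := simDiag_correct hX (P := P) (C := C)
      (fun l => (hC l).symm) hgh.1 hgh.2.1 hgh.2.2
    refine ⟨⟨_, .extract hP hd s z x y hxy⟩, fun out hout => ?_⟩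
    cases hout with
    | certify _ hd' => exact absurd hd' hd
    | extract _ _ r z x y hdiag =>
      obtain ⟨π, α, hα, hx⟩ := huniq r z x y hdiag
      exact ⟨hs, π, α, hα, fun i =>
        (congrArg unvec (hx i)).trans (unvec_smul_vec (α i) (planted w (π i)))⟩
    | giveUp _ _ hno => exact hno s z x y hxy

end GenericInput
end JLV

theorem corollary2p5 (m n R s : ℕ) (hm : 2 ≤ m) (hn : 2 ≤ n) (hs : s ≤ R)
    (hR : (R : ℝ) ≤ 1 / 2 * ((m : ℝ) - 1) * ((n : ℝ) - 2)) :
    JLV.Generic fun w : JLV.Var m n R s → ℝ =>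
      ∀ (k : ℕ) (u : Fin k → JLV.Mat m n), JLV.IsBasisOf u (JLV.plantedSubspace w) →
      ∀ (d : ℕ) (P : Fin d → JLV.Tensor m n), JLV.IsBasisOf P (JLV.stepOneSpace u) →
        JLV.Generic fun gh : Fin d ⊕ Fin d → ℝ =>
          (∃ out, JLV.Run u P (fun l => gh (.inl l)) (fun l => gh (.inr l)) out) ∧
          ∀ out, JLV.Run u P (fun l => gh (.inl l)) (fun l => gh (.inr l)) out →
            out.Succeeds (JLV.planted w) (JLV.plantedSubspace w) := by
  have hR' : R ≤ (m - 1) * (n / 2) := by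
    have h1 : 2 * R ≤ (m - 1) * (n - 2) := by
      have : (2 * R : ℝ) ≤ ((m - 1 : ℕ) : ℝ) * ((n - 2 : ℕ) : ℝ) := by
        rw [Nat.cast_sub hn, Nat.cast_sub (by omega : 1 ≤ m)]
        push_cast
        linarith
      exact_mod_cast this
    have h2 : (m - 1) * (n - 2) ≤ (m - 1) * (2 * (n / 2)) := Nat.mul_le_mul_left _ (by omega)
    linarith
  exact (JLV.generic_minorIndependent hm hs hR').mono fun w hw k u hu d P hP =>
    JLV.generic_run_succeeds hw.1 hw.2 hu hP
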